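/- Setting. Identify the circle $\mathbb S$ with $\mathbb R/\mathbb Z$. For an orientation-preserving homeomorphism $g$ of $\mathbb S$ and a lift $\hat g\in\mathrm{Homeo}^+(\mathbb R)$ of $g$, the rotation number is $\mathrm{rot}(g)=\lim_{i\to\infty}\hat g^{\,i}(x)/i \bmod \mathbb Z$ (independent of $x$ and of the lift). Let $g$ be an element of Thompson's group $T$, i.e. a homeomorphism of $\mathbb S$ represented by two finite rooted binary trees with the same number $n\ge 1$ of leaves and a cyclic permutation $i\mapsto i+k \pmod n$, $0\le k<n$: the standard dyadic interval of the $i$-th leaf ($0\le i<n$) of the first tree is mapped affinely, preserving orientation, onto that of the $(i+k \bmod n)$-th leaf of the second. The diagram. Draw the carets of the first tree as splits (one incoming edge, a left and a right outgoing edge) and those of the second tree as merges (a left and a right incoming edge, one outgoing edge); the $i$-th leaf edge of the first tree is continued into the $(i+k\bmod n)$-th leaf edge of the second, and the edge leaving the root of the second tree is continued into the edge entering the root of the first. Every edge gets a red and a blue label (its numbers of crossings of the two seams of the torus on which the diagram is drawn): the edge joining the two roots has red label $1$, all others have red label $0$; the strand starting at the $i$-th leaf has blue label $1$ if $i+k\ge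 n$, and all other edges have blue label $0$. (If $n=1$ the diagram is one circle without vertices, with red label $1$ and blue label $0$.) Rule I. If an edge with label $y$ goes from a merge to a split, delete this edge together with the merge and the split, join the left (right) incoming edge of the merge to the left (right) outgoing edge of the split, and for each colour let the label of each resulting edge be the sum of the labels of the edges that were joined to form it, plus $y$ for each of the two junctions on it. (If some of the four edges coincide, the same description applies; an edge joined to itself becomes a circle without vertices.) Theorem. For every $g\in T$, and for every pair of trees representing $g$, start from the diagram above and apply Rule I repeatedly, in any order, for both colours, until no edge goes from a merge to a split. Rule I can be applied as long as there is such an edge, and the procedure terminates. Any final diagram contains an oriented cycle (a circle without vertices, or a closed oriented path), and for every oriented cycle of it, if $a$ (resp. $b$) is the sum of the blue (resp. red) labels along the cycle, then $b>0$ and $\mathrm{rot}(g)=\frac ab \bmod \mathbb Z$. -/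

import Mathlib

open Filter Topology

namespace RotT

/-! ### Rotation numbers -/

/-- `F ∈ Homeo⁺(ℝ)` (an order automorphism of `ℝ`) is a lift of the homeomorphism `g` of the
circle `ℝ/ℤ`. -/
def IsLift (F : ℝ ≃o ℝ) (g : UnitAddCircle ≃ₜ UnitAddCircle) : Prop :=
  ∀ x : ℝ, ((F x : ℝ) : UnitAddCircle) = g (x : UnitAddCircle)

/-- `g` is an orientation-preserving homeomorphism of the circle with rotation number
`ρ ∈ ℝ/ℤ`: it has a lift in `Homeo⁺(ℝ)`, and for every such lift `F` the limit of `Fⁱ(x)/i`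
exists, does not depend on `x`, and is equal to `ρ` modulo `ℤ`. -/
def HasRotationNumber (g : UnitAddCircle ≃ₜ UnitAddCircle) (ρ : UnitAddCircle) : Prop :=
  (∃ F : ℝ ≃o ℝ, IsLift F g) ∧
    ∀ F : ℝ ≃o ℝ, IsLift F g →
      ∃ r : ℝ, (r : UnitAddCircle) = ρ ∧
        ∀ x : ℝ, Tendsto (fun i : ℕ => (F^[i]) x / (i : ℝ)) atTop (𝓝 r)

/-! ### Thompson's group `T` by pairs of trees -/

/-- A vertex of a binary tree is given by its address, the list of turns on the way from the root
(`false` is left, `true` is right). These are the addresses of the leaves, from left to right. -/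
def leaves : BinaryTree Unit → List (List Bool)
  | .nil => [[]]
  | .node _ l r => (leaves l).map (List.cons false) ++ (leaves r).map (List.cons true)

/-- The addresses of the carets (the internal vertices) of a binary tree. -/
def carets : BinaryTree Unit → List (List Bool)
  | .nil => []
  | .node _ l r => [] :: ((carets l).map (List.cons false) ++ (carets r).map (List.cons true))

theorem length_leaves (A : BinaryTree Unit) : (leaves A).length = A.numLeaves := by
  induction A with
  | nil => rfl
  | node _ l r hl hr => simp [leaves, BinaryTree.numLeaves, hl, hr]

theorem length_carets (A : BinaryTree Unit) : (carets A).length = A.numNodes := by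
  induction A with
  | nil => rfl
  | node _ l r hl hr => simp [carets, BinaryTree.numNodes, hl, hr]

/-- The affine map of `[0,1)` onto the dyadic interval with address `u`, which puts the prefix `u`
in front of a binary expansion: `0.t ↦ 0.ut`. -/
noncomputable def addPrefix : List Bool → ℝ → ℝ
  | [], t => t
  | b :: u, t => ((if b then 1 else 0) + addPrefix u t) / 2

/-- A pair of binary trees with the same number `n` of leaves, together with the cyclic permutation
`i ↦ i + shift` (mod `n`) from the leaves of the first to the leaves of the second. -/
structure TreePair where
  dom : BinaryTree Unit
  ran : BinaryTree Unit
  numLeaves_eq : dom.numLeaves = ran.numLeaves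
  shift : ℕ
  shift_lt : shift < dom.numLeaves

namespace TreePair

/-- The number of leaves of each of the trees. -/
def n (P : TreePair) : ℕ := P.dom.numLeaves

/-- The address of the `i`-th leaf of the first tree, `i < n`. -/
def domLeaf (P : TreePair) (i : ℕ) : List Bool := (leaves P.dom).getD i []

/-- The address of the leaf of the second tree which corresponds to the `i`-th leaf of the first
tree, `i < n`. -/
def ranLeaf (P : TreePair) (i : ℕ) : List Bool := (leaves P.ran).getD ((i + P.shift) % P.n) []

/-- The pair of trees represents the homeomorphism `g` of `ℝ/ℤ`: the dyadic interval of each leaf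
of the first tree is mapped affinely onto that of the corresponding leaf of the second. -/
def Represents (P : TreePair) (g : UnitAddCircle ≃ₜ UnitAddCircle) : Prop :=
  ∀ i < P.n, ∀ t ∈ Set.Ico (0 : ℝ) 1,
    g ((addPrefix (P.domLeaf i) t : ℝ) : UnitAddCircle) =
      ((addPrefix (P.ranLeaf i) t : ℝ) : UnitAddCircle)

end TreePair

/-- (The underlying set of) Thompson's group `T`, acting on the circle `ℝ/ℤ`. -/
def thompsonT : Set (UnitAddCircle ≃ₜ UnitAddCircle) :=
  {g | ∃ P : TreePair, P.Represents g}

/-! ### Labelled closed strand diagrams -/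

/-- The vertices of the diagrams: splits and merges, named by addresses of carets. -/
inductive Vertex
  | split (u : List Bool)
  | merge (w : List Bool)

/-- The places where an oriented edge can start: the left (`false`) and the right (`true`) exit of
a split, and the exit of a merge. -/
inductive OutPort
  | splitOut (b : Bool) (u : List Bool)
  | mergeOut (w : List Bool)

/-- The places where an oriented edge can end: the entrance of a split, and the left (`false`) and
the right (`true`) entrance of a merge. -/
inductive InPort
  | splitIn (u : List Bool)
  | mergeIn (b : Bool) (w : List Bool)

/-- The vertex to which a place belongs. -/
def OutPort.vertex : OutPort → Vertex
  | .splitOut _ u => .split u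
  | .mergeOut w => .merge w

/-- The vertex to which a place belongs. -/
def InPort.vertex : InPort → Vertex
  | .splitIn u => .split u
  | .mergeIn _ w => .merge w

/-- A label `(red, blue)`: the numbers of crossings of the red and of the blue seam. -/
abbrev Label : Type := ℕ × ℕ

/-- A labelled oriented edge. Naming its ends by places records the rotation system. -/
structure Edge where
  src : OutPort
  tgt : InPort
  label : Label

/-- A labelled closed diagram: its edges, and the labels of its free circles (the components
without any vertex). -/
structure Diagram where
  edges : Multiset Edge
  circles : Multiset Label

/-- Joining the edge that ends at `p` to the edge that starts at `q`, with an additional label `y`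
at the junction. If these are two edges, they become one; if this is one and the same edge, then
it becomes a free circle. All labels are added. -/
inductive Join (p : InPort) (q : OutPort) (y : Label) : Diagram → Diagram → Prop
  | edge (a : OutPort) (b : InPort) (x z : Label) (E : Multiset Edge) (C : Multiset Label) :
      Join p q y ⟨⟨a, p, x⟩ ::ₘ ⟨q, b, z⟩ ::ₘ E, C⟩ ⟨⟨a, b, x + y + z⟩ ::ₘ E, C⟩
  | circle (x : Label) (E : Multiset Edge) (C : Multiset Label) :
      Join p q y ⟨⟨q, p, x⟩ ::ₘ E, C⟩ ⟨E, (x + y) ::ₘ C⟩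

/-- Rule I, with labels: an edge with label `y` from a merge `w` to a split `u` is removed together
with `w` and `u`; the left entrance of `w` is joined to the left exit of `u`, the right entrance of
`w` to the right exit of `u`, and the central label `y` is added to both. -/
def RuleI (D D' : Diagram) : Prop :=
  ∃ (w u : List Bool) (y : Label) (E : Multiset Edge) (D₁ : Diagram),
    D.edges = ⟨.mergeOut w, .splitIn u, y⟩ ::ₘ E ∧
    Join (.mergeIn false w) (.splitOut false u) y ⟨E, D.circles⟩ D₁ ∧
    Join (.mergeIn true w) (.splitOut true u) y D₁ D'

namespace Diagram

/-- There are no more merge-split pairs, i.e. no edge goes from a merge to a split. -/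
def IsReduced (D : Diagram) : Prop :=
  ¬ ∃ (w u : List Bool) (y : Label), (⟨.mergeOut w, .splitIn u, y⟩ : Edge) ∈ D.edges

/-- `a` (resp. `b`) is the sum of the blue (resp. red) labels along some oriented cycle of `D`,
which is either a free circle or a closed oriented path, i.e. a non-empty cyclic sequence of edges
each of which ends at the vertex where the next one starts. -/
def HasCycle (D : Diagram) (a b : ℕ) : Prop :=
  (b, a) ∈ D.circles ∨
    ∃ c : List Edge, c ≠ [] ∧ (∀ e ∈ c, e ∈ D.edges) ∧
      (c : Cycle Edge).Chain (fun e f => e.tgt.vertex = f.src.vertex) ∧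
      (c.map fun e => e.label.2).sum = a ∧ (c.map fun e => e.label.1).sum = b

end Diagram

/-! ### The diagram of a pair of trees on the torus

The carets of the first tree are splits, those of the second one are merges. The edge above the
root of the first tree comes, through the red seam, from below the root of the second tree. -/

/-- Where the edge to the vertex `u` of the first tree starts. -/
def above (u : List Bool) : OutPort :=
  match u.getLast? with
  | none => .mergeOut []
  | some b => .splitOut b u.dropLast

/-- Where the edge from the vertex `w` of the second tree ends. -/
def below (w : List Bool) : InPort :=
  match w.getLast? with
  | none => .splitIn []
  | some b => .mergeIn b w.dropLast

/-- The labelled diagram of a pair of trees on the torus. The strand from the `i`-th leaf of the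
first tree to the corresponding leaf of the second one is drawn going to the right by `shift`
places, so it crosses the blue seam once if `n ≤ i + shift`, and otherwise it does not cross it.
Only the edge that joins the two roots crosses the red seam. When the trees are trivial, this edge
is a free circle. -/
def TreePair.torusDiagram (P : TreePair) : Diagram :=
  if P.n = 1 then ⟨0, {(1, 0)}⟩
  else
    { edges :=
        Multiset.ofList
          ((carets P.dom).map (fun u =>
              ⟨above u, .splitIn u, if u = [] then (1, 0) else (0, 0)⟩) ++
            ((carets P.ran).filter (fun w => w ≠ [])).map (fun w =>
              ⟨.mergeOut w, below w, (0, 0)⟩) ++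
            (List.range P.n).map (fun i =>
              ⟨above (P.domLeaf i), below (P.ranLeaf i),
                if P.n ≤ i + P.shift then (0, 1) else (0, 0)⟩))
      circles := 0 }

end RotT

namespace RotT

/-! ### Lifts of homeomorphisms of the circle -/

theorem coe_add_intCast (x : ℝ) (m : ℤ) : ((x + m : ℝ) : UnitAddCircle) = x := by
  have h : ((m : ℝ) : UnitAddCircle) = 0 := (AddCircle.coe_eq_zero_iff (1 : ℝ)).2 ⟨m, by simp⟩
  rw [AddCircle.coe_add, h, add_zero]

theorem exists_eq_add_intCast {x y : ℝ} (h : (x : UnitAddCircle) = y) :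
    ∃ m : ℤ, x = y + m := by
  have h' : ((x - y : ℝ) : UnitAddCircle) = 0 := by rw [AddCircle.coe_sub, h, sub_self]
  obtain ⟨m, hm⟩ := (AddCircle.coe_eq_zero_iff (1 : ℝ)).1 h'
  refine ⟨m, ?_⟩
  have : (m : ℝ) = x - y := by simpa using hm
  linarith

/-- Two lifts of the same homeomorphism differ by an integer translation. -/
theorem IsLift.exists_eq_add_intCast {F G : ℝ ≃o ℝ} {g : UnitAddCircle ≃ₜ UnitAddCircle}
    (hF : IsLift F g) (hG : IsLift G g) : ∃ m : ℤ, ∀ x, G x = F x + m := by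
  have h : ∀ x, ∃ m : ℤ, G x - F x = m := fun x => by
    obtain ⟨m, hm⟩ := RotT.exists_eq_add_intCast ((hG x).trans (hF x).symm)
    exact ⟨m, by rw [hm]; ring⟩
  choose m hm using h
  have hc : Continuous fun x => ((m x : ℤ) : ℝ) := by
    simp_rw [← hm]
    exact G.continuous.sub F.continuous
  have hc' : Continuous m := Int.isClosedEmbedding_coe_real.isEmbedding.continuous_iff.2 hc
  refine ⟨m 0, fun x => ?_⟩
  have h1 : m x = m 0 := PreconnectedSpace.constant inferInstance hc'
  rw [← h1, ← hm]
  ring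

/-- A homeomorphism with a degree one lift that has a periodic point modulo `ℤ` has the
corresponding rational rotation number. -/
theorem hasRotationNumber_of_pow_eq {F : ℝ ≃o ℝ} {g : UnitAddCircle ≃ₜ UnitAddCircle}
    (hF : IsLift F g) {f : CircleDeg1Lift} (hf : ⇑f = F) {a b : ℕ} (hb : 0 < b) {x : ℝ}
    (hx : (f ^ b) x = x + a) :
    HasRotationNumber g (((a : ℝ) / (b : ℝ) : ℝ) : UnitAddCircle) := by
  refine ⟨⟨F, hF⟩, fun G hG => ?_⟩
  obtain ⟨m, hm⟩ := hF.exists_eq_add_intCast hG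
  have hτ : f.translationNumber = (a : ℝ) / b := by
    have := f.translationNumber_of_map_pow_eq_add_int (x := x) (n := b) (m := a)
      (by simpa using hx) hb
    simpa using this
  refine ⟨a / b + m, coe_add_intCast _ _, fun y => ?_⟩
  have hit : ∀ i : ℕ, G^[i] y = (f ^ i) y + i * m := by
    intro i
    induction i with
    | zero => simp
    | succ i ih =>
      rw [Function.iterate_succ_apply', ih, hm, pow_succ', CircleDeg1Lift.mul_apply]
      have : ((f ^ i) y + i * m : ℝ) = (f ^ i) y + ((i * m : ℤ) : ℝ) := by push_cast; ring
      rw [this, ← hf, f.map_add_int]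
      push_cast
      ring
  have h1 := f.tendsto_translationNumber y
  rw [hτ] at h1
  have h2 : Tendsto (fun i : ℕ => y / (i : ℝ)) atTop (𝓝 0) :=
    tendsto_const_nhds.div_atTop tendsto_natCast_atTop_atTop
  have h3 := (h1.add h2).add_const (m : ℝ)
  rw [add_zero] at h3
  refine h3.congr' ?_
  filter_upwards [eventually_gt_atTop 0] with i hi
  have hi' : (i : ℝ) ≠ 0 := by positivity
  rw [hit]
  field_simp
  ring

/-- The extension of a map from `[0,1)` to `ℝ` that commutes with integer translations. -/
noncomputable def periodize (F₀ : ℝ → ℝ) (x : ℝ) : ℝ := F₀ (Int.fract x) + ⌊x⌋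

theorem periodize_add_one (F₀ : ℝ → ℝ) (x : ℝ) : periodize F₀ (x + 1) = periodize F₀ x + 1 := by
  simp [periodize, add_assoc]

theorem periodize_of_mem {F₀ : ℝ → ℝ} {x : ℝ} (hx : x ∈ Set.Ico (0 : ℝ) 1) :
    periodize F₀ x = F₀ x := by
  simp [periodize, Int.fract_eq_self.2 hx, Int.floor_eq_zero_iff.2 hx]

theorem strictMono_periodize {F₀ : ℝ → ℝ} (h₀ : StrictMonoOn F₀ (Set.Ico 0 1))
    (h₁ : ∀ x ∈ Set.Ico (0 : ℝ) 1, F₀ x < F₀ 0 + 1) : StrictMono (periodize F₀) := by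
  intro x y hxy
  have hx : Int.fract x ∈ Set.Ico (0 : ℝ) 1 := ⟨Int.fract_nonneg x, Int.fract_lt_one x⟩
  have hy : Int.fract y ∈ Set.Ico (0 : ℝ) 1 := ⟨Int.fract_nonneg y, Int.fract_lt_one y⟩
  unfold periodize
  rcases (Int.floor_mono hxy.le).lt_or_eq with h | h
  · have h2 := h₁ _ hx
    have h3 := h₀.monotoneOn ⟨le_rfl, one_pos⟩ hy hy.1
    have h4 : (⌊x⌋ : ℝ) + 1 ≤ ⌊y⌋ := by exact_mod_cast h
    linarith
  · rw [h, add_lt_add_iff_right]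
    refine h₀ hx hy ?_
    rw [Int.fract, Int.fract, h]
    linarith

/-! ### The piecewise affine parametrization by the leaves of a tree -/

/-- The map that sends `[i, i + 1]` affinely onto the dyadic interval of the `i`-th leaf. -/
noncomputable def leafParam : BinaryTree Unit → ℝ → ℝ
  | .nil, x => x
  | .node _ l r, x =>
    if x < l.numLeaves then leafParam l x / 2 else (1 + leafParam r (x - l.numLeaves)) / 2

theorem leafParam_zero (A : BinaryTree Unit) : leafParam A 0 = 0 := by
  induction A with
  | nil => rfl
  | node _ l r hl _ => simp [leafParam, l.numLeaves_pos, hl]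

theorem leafParam_numLeaves (A : BinaryTree Unit) : leafParam A A.numLeaves = 1 := by
  induction A with
  | nil => simp [leafParam, BinaryTree.numLeaves]
  | node _ l r _ hr => simp [leafParam, BinaryTree.numLeaves, hr]

theorem strictMono_leafParam (A : BinaryTree Unit) : StrictMono (leafParam A) := by
  induction A with
  | nil => exact strictMono_id
  | node _ l r hl hr =>
    intro x y hxy
    simp only [leafParam]
    split_ifs with hx hy hy
    · linarith [hl hxy]
    · have h1 := hl hx
      have h2 := hr.monotone (sub_nonneg.2 (not_lt.1 hy))
      rw [leafParam_numLeaves] at h1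
      rw [leafParam_zero] at h2
      linarith
    · exact absurd (hxy.trans hy) hx
    · linarith [hr (sub_lt_sub_right hxy (l.numLeaves : ℝ))]

theorem surjective_leafParam (A : BinaryTree Unit) : Function.Surjective (leafParam A) := by
  induction A with
  | nil => exact Function.surjective_id
  | node _ l r hl hr =>
    intro y
    rcases lt_or_ge (2 * y) 1 with h | h
    · obtain ⟨x, hx⟩ := hl (2 * y)
      have : x < l.numLeaves := by
        rwa [← (strictMono_leafParam l).lt_iff_lt, leafParam_numLeaves, hx]
      exact ⟨x, by simp [leafParam, this, hx]⟩
    · obtain ⟨x, hx⟩ := hr (2 * y - 1)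
      have : 0 ≤ x := by
        rw [← (strictMono_leafParam r).le_iff_le, leafParam_zero, hx]
        linarith
      exact ⟨x + l.numLeaves, by simp [leafParam, this, hx]⟩

theorem leafParam_add (A : BinaryTree Unit) {i : ℕ} (hi : i < A.numLeaves) {t : ℝ}
    (ht : t ∈ Set.Ico (0 : ℝ) 1) : leafParam A (i + t) = addPrefix ((leaves A).getD i []) t := by
  induction A generalizing i with
  | nil =>
    have : i = 0 := by simpa [BinaryTree.numLeaves] using hi
    simp [this, leafParam, leaves, addPrefix]
  | node _ l r hl hr =>
    rw [BinaryTree.numLeaves] at hi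
    by_cases h : i < l.numLeaves
    · have h1 : (i : ℝ) + t < l.numLeaves := by
        have : (i : ℝ) + 1 ≤ l.numLeaves := by exact_mod_cast h
        linarith [ht.2]
      have h2 : i < (leaves l).length := by rwa [length_leaves]
      have := hl h
      rw [List.getD_eq_getElem _ _ h2] at this
      rw [leafParam, if_pos h1, leaves, List.getD_append _ _ _ _ (by simpa using h2),
        List.getD_eq_getElem _ _ (by simpa using h2)]
      simp [addPrefix, this]
    · have h1 : ¬ (i : ℝ) + t < l.numLeaves := by
        have : (l.numLeaves : ℝ) ≤ i := by exact_mod_cast not_lt.1 h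
        linarith [ht.1]
      have h2 : i - l.numLeaves < (leaves r).length := by rw [length_leaves]; omega
      have := hr (i := i - l.numLeaves) (by omega)
      rw [List.getD_eq_getElem _ _ h2, Nat.cast_sub (not_lt.1 h)] at this
      rw [leafParam, if_neg h1, leaves,
        List.getD_append_right _ _ _ _ (by simpa [length_leaves] using h),
        List.getD_eq_getElem _ _ (by simpa [length_leaves] using h2)]
      have e : (i : ℝ) + t - l.numLeaves = i - l.numLeaves + t := by ring
      simp [addPrefix, e, this, length_leaves]

/-! ### The lift determined by a pair of trees -/

/-- The parametrization by the leaves of a tree as an order isomorphism. -/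
noncomputable def leafIso (A : BinaryTree Unit) : ℝ ≃o ℝ :=
  (strictMono_leafParam A).orderIsoOfSurjective _ (surjective_leafParam A)

theorem leafIso_apply (A : BinaryTree Unit) (x : ℝ) : leafIso A x = leafParam A x := rfl

/-- The restriction to `[0,1)` of the lift determined by a pair of trees. -/
noncomputable def TreePair.baseLift (P : TreePair) (x : ℝ) : ℝ :=
  let s := (leafIso P.dom).symm x + P.shift
  if s < P.n then leafParam P.ran s else leafParam P.ran (s - P.n) + 1

theorem TreePair.baseLift_leaf (P : TreePair) {i : ℕ} (hi : i < P.n) {t : ℝ}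
    (ht : t ∈ Set.Ico (0 : ℝ) 1) :
    P.baseLift (addPrefix (P.domLeaf i) t) =
      addPrefix (P.ranLeaf i) t + if P.n ≤ i + P.shift then 1 else 0 := by
  have hs : (leafIso P.dom).symm (addPrefix (P.domLeaf i) t) = i + t := by
    rw [OrderIso.symm_apply_eq, leafIso_apply, leafParam_add _ hi ht, TreePair.domLeaf]
  have hk : P.shift < P.n := P.shift_lt
  have hn : P.ran.numLeaves = P.n := P.numLeaves_eq.symm
  simp only [TreePair.baseLift, hs, TreePair.ranLeaf]
  by_cases h : P.n ≤ i + P.shift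
  · have h1 : ¬ (i : ℝ) + t + P.shift < P.n := by
      have : (P.n : ℝ) ≤ i + P.shift := by exact_mod_cast h
      linarith [ht.1]
    have h2 : (i + P.shift) % P.n = i + P.shift - P.n := by
      rw [Nat.mod_eq_sub_mod h, Nat.mod_eq_of_lt (by omega)]
    rw [if_neg h1, if_pos h, h2, ← leafParam_add _ (by omega) ht, Nat.cast_sub h, Nat.cast_add]
    congr 2
    ring
  · have h1 : (i : ℝ) + t + P.shift < P.n := by
      have : (i : ℝ) + P.shift + 1 ≤ P.n := by exact_mod_cast not_le.1 h
      linarith [ht.2]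
    rw [if_pos h1, if_neg h, Nat.mod_eq_of_lt (not_le.1 h), ← leafParam_add _ (by omega) ht,
      Nat.cast_add, add_zero]
    congr 1
    ring

theorem TreePair.exists_leaf (P : TreePair) {x : ℝ} (hx : x ∈ Set.Ico (0 : ℝ) 1) :
    ∃ i < P.n, ∃ t ∈ Set.Ico (0 : ℝ) 1, x = addPrefix (P.domLeaf i) t := by
  obtain ⟨s, rfl⟩ := surjective_leafParam P.dom x
  have h0 : 0 ≤ s := by
    rw [← (strictMono_leafParam P.dom).le_iff_le, leafParam_zero]
    exact hx.1
  have h1 : s < P.dom.numLeaves := by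
    rw [← (strictMono_leafParam P.dom).lt_iff_lt, leafParam_numLeaves]
    exact hx.2
  have h2 : ⌊s⌋₊ < P.n := (Nat.floor_lt h0).2 h1
  have h3 : s - ⌊s⌋₊ ∈ Set.Ico (0 : ℝ) 1 :=
    ⟨sub_nonneg.2 (Nat.floor_le h0), by linarith [Nat.lt_floor_add_one s]⟩
  refine ⟨⌊s⌋₊, h2, s - ⌊s⌋₊, h3, ?_⟩
  rw [TreePair.domLeaf, ← leafParam_add P.dom h2 h3, add_sub_cancel]

theorem TreePair.strictMono_baseLift (P : TreePair) : StrictMono P.baseLift := by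
  intro x y hxy
  have h := (leafIso P.dom).symm.strictMono hxy
  have hr := strictMono_leafParam P.ran
  have hn : leafParam P.ran P.n = 1 := by
    rw [TreePair.n, P.numLeaves_eq, leafParam_numLeaves]
  simp only [TreePair.baseLift]
  split_ifs with h1 h2 h2
  · exact hr (by linarith)
  · have h3 := hr h1
    have h4 := hr.monotone (sub_nonneg.2 (not_lt.1 h2))
    rw [leafParam_zero] at h4
    linarith
  · linarith
  · have := hr (a := (leafIso P.dom).symm x + P.shift - P.n)
      (b := (leafIso P.dom).symm y + P.shift - P.n) (by linarith)
    linarith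

theorem TreePair.baseLift_lt (P : TreePair) {x : ℝ} (hx : x ∈ Set.Ico (0 : ℝ) 1) :
    P.baseLift x < P.baseLift 0 + 1 := by
  have hr := strictMono_leafParam P.ran
  have hn : leafParam P.ran P.n = 1 := by
    rw [TreePair.n, P.numLeaves_eq, leafParam_numLeaves]
  have hk : (P.shift : ℝ) < P.n := by exact_mod_cast P.shift_lt
  have h0 : (leafIso P.dom).symm 0 = 0 := by
    rw [OrderIso.symm_apply_eq, leafIso_apply, leafParam_zero]
  have h1 : (leafIso P.dom).symm 1 = P.n := by
    rw [OrderIso.symm_apply_eq, leafIso_apply, TreePair.n, leafParam_numLeaves]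
  have hs := (leafIso P.dom).symm.strictMono hx.2
  rw [h1] at hs
  simp only [TreePair.baseLift, h0, zero_add, if_pos hk]
  split_ifs with h
  · have h2 := hr h
    have h3 := hr.monotone (Nat.cast_nonneg (α := ℝ) P.shift)
    rw [leafParam_zero] at h3
    linarith
  · have := hr (a := (leafIso P.dom).symm x + P.shift - P.n) (b := P.shift) (by linarith)
    linarith

theorem continuous_addPrefix (u : List Bool) : Continuous (addPrefix u) := by
  induction u with
  | nil => exact continuous_id
  | cons b u ih => exact (continuous_const.add ih).div_const 2

/-- A homeomorphism represented by a pair of trees has a lift which maps the interval of each leaf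
affinely onto the interval of the corresponding leaf, moved by `1` if the strand crosses the
seam. -/
theorem TreePair.Represents.exists_isLift {P : TreePair} {g : UnitAddCircle ≃ₜ UnitAddCircle}
    (hP : P.Represents g) :
    ∃ F : ℝ ≃o ℝ, IsLift F g ∧ (∀ x, F (x + 1) = F x + 1) ∧
      ∀ i < P.n, ∀ t ∈ Set.Icc (0 : ℝ) 1, F (addPrefix (P.domLeaf i) t) =
        addPrefix (P.ranLeaf i) t + if P.n ≤ i + P.shift then 1 else 0 := by
  have hmono : StrictMono (periodize P.baseLift) :=
    strictMono_periodize (P.strictMono_baseLift.strictMonoOn _) fun x hx => P.baseLift_lt hx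
  have hadd : ∀ x (m : ℤ), periodize P.baseLift (x + m) = periodize P.baseLift x + m := by
    intro x m
    simp [periodize, add_assoc]
  have hlift : ∀ x : ℝ, ((periodize P.baseLift x : ℝ) : UnitAddCircle) = g x := by
    intro x
    have hx : Int.fract x ∈ Set.Ico (0 : ℝ) 1 := ⟨Int.fract_nonneg x, Int.fract_lt_one x⟩
    obtain ⟨i, hi, t, ht, h⟩ := P.exists_leaf hx
    have hx' : (x : UnitAddCircle) = (Int.fract x : ℝ) := by
      conv_lhs => rw [← Int.fract_add_floor x, coe_add_intCast]
    rw [periodize, coe_add_intCast, hx', h, P.baseLift_leaf hi ht, hP i hi t ht]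
    split_ifs
    · exact_mod_cast coe_add_intCast (addPrefix (P.ranLeaf i) t) 1
    · rw [add_zero]
  have hsurj : Function.Surjective (periodize P.baseLift) := by
    intro y
    obtain ⟨x, hx⟩ := QuotientAddGroup.mk_surjective (g.symm (y : UnitAddCircle))
    have h1 : ((periodize P.baseLift x : ℝ) : UnitAddCircle) = y := by
      rw [hlift]
      exact (congrArg g hx).trans (g.apply_symm_apply _)
    obtain ⟨m, hm⟩ := exists_eq_add_intCast h1.symm
    exact ⟨x + m, by rw [hadd, hm]⟩
  refine ⟨hmono.orderIsoOfSurjective _ hsurj, hlift, periodize_add_one _, fun i hi => ?_⟩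
  set F := hmono.orderIsoOfSurjective _ hsurj with hF
  have heq : Set.EqOn (fun t => F (addPrefix (P.domLeaf i) t)) (fun t =>
      addPrefix (P.ranLeaf i) t + if P.n ≤ i + P.shift then 1 else 0) (Set.Ico 0 1) := by
    intro t ht
    have hmem : addPrefix (P.domLeaf i) t ∈ Set.Ico (0 : ℝ) 1 := by
      rw [TreePair.domLeaf, ← leafParam_add _ hi ht]
      constructor
      · rw [← leafParam_zero P.dom, (strictMono_leafParam P.dom).le_iff_le]
        linarith [ht.1, Nat.cast_nonneg (α := ℝ) i]
      · rw [← leafParam_numLeaves P.dom, (strictMono_leafParam P.dom).lt_iff_lt]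
        have : (i : ℝ) + 1 ≤ P.dom.numLeaves := by exact_mod_cast hi
        linarith [ht.2]
    exact (periodize_of_mem hmem).trans (P.baseLift_leaf hi ht)
  have := heq.closure (F.continuous.comp (continuous_addPrefix _))
    ((continuous_addPrefix _).add continuous_const)
  rw [closure_Ico zero_ne_one] at this
  exact this

/-! ### Coordinates on a diagram -/

/-- A height at each vertex and a chart from the unit interval to the line at each vertex, together
with a lift of a circle homeomorphism and a bound for the loss of height at the red seam. -/
structure Coordinates where
  lift : CircleDeg1Lift
  weight : ℤ
  chart : Vertex → ℝ → ℝ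
  height : Vertex → ℤ

namespace Coordinates

variable (K : Coordinates)

/-- The chart at the beginning of an edge. -/
noncomputable def outChart : OutPort → ℝ → ℝ
  | .splitOut b u, t => K.chart (.split u) (addPrefix [b] t)
  | .mergeOut w, t => K.chart (.merge w) t

/-- The chart at the end of an edge. -/
noncomputable def inChart : InPort → ℝ → ℝ
  | .splitIn u, t => K.chart (.split u) t
  | .mergeIn b w, t => K.chart (.merge w) (addPrefix [b] t)

/-- Moving along a strand with label `l` from a place with height `h` and chart `φ` to a place with
height `k` and chart `ψ` corresponds to applying the lift `l.1` times, up to a translation by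
`l.2`. -/
structure Transports (φ : ℝ → ℝ) (h : ℤ) (l : Label) (ψ : ℝ → ℝ) (k : ℤ) : Prop where
  chart_eq : ∀ t ∈ Set.Icc (0 : ℝ) 1, (K.lift ^ l.1) (φ t) = ψ t + l.2
  height_lt : h < k + K.weight * l.1

variable {K}

theorem Transports.trans {φ ψ χ : ℝ → ℝ} {h k m : ℤ} {l l' : Label}
    (h₁ : K.Transports φ h l ψ k) (h₂ : K.Transports ψ k l' χ m) :
    K.Transports φ h (l + l') χ m where
  chart_eq t ht := by
    rw [Prod.fst_add, Prod.snd_add, add_comm l.1, pow_add, CircleDeg1Lift.mul_apply,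
      h₁.chart_eq t ht, CircleDeg1Lift.map_add_nat, h₂.chart_eq t ht]
    push_cast
    ring
  height_lt := by
    have := h₁.height_lt
    have := h₂.height_lt
    rw [Prod.fst_add]
    push_cast
    linarith

variable (K)

/-- The label of a circle is the displacement of a periodic point. -/
def IsPeriod (l : Label) : Prop := 0 < l.1 ∧ ∃ x, (K.lift ^ l.1) x = x + l.2

variable {K}

theorem Transports.isPeriod {φ ψ : ℝ → ℝ} {h : ℤ} {l : Label}
    (H : K.Transports φ h l ψ h) {s t : ℝ} (ht : t ∈ Set.Icc (0 : ℝ) 1) (hs : φ t = s)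
    (hs' : ψ t = s) : K.IsPeriod l := by
  constructor
  · by_contra h0
    have := H.height_lt
    simp [Nat.eq_zero_of_not_pos h0] at this
  · exact ⟨s, by rw [← hs, H.chart_eq t ht, hs', hs]⟩

variable (K)

/-- The coordinates are compatible with all labels of the diagram. -/
structure Compatible (D : Diagram) : Prop where
  edges : ∀ e ∈ D.edges, K.Transports (K.outChart e.src) (K.height e.src.vertex) e.label
    (K.inChart e.tgt) (K.height e.tgt.vertex)
  circles : ∀ l ∈ D.circles, K.IsPeriod l

variable {K}

theorem Compatible.join {p : InPort} {q : OutPort} {y : Label} {D D' : Diagram}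
    (hD : K.Compatible D) (hj : Join p q y D D')
    (hy : K.Transports (K.inChart p) (K.height p.vertex) y (K.outChart q) (K.height q.vertex)) :
    K.Compatible D' := by
  cases hj with
  | edge a b x z E C =>
    refine ⟨fun e he => ?_, hD.circles⟩
    rcases Multiset.mem_cons.1 he with rfl | he
    · exact ((hD.edges ⟨a, p, x⟩ (by simp)).trans hy).trans (hD.edges ⟨q, b, z⟩ (by simp))
    · exact hD.edges e (by simp [he])
  | circle x E C =>
    refine ⟨fun e he => hD.edges e (by simp [he]), fun l hl => ?_⟩
    rcases Multiset.mem_cons.1 hl with rfl | hl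
    · exact ((hD.edges ⟨q, p, x⟩ (by simp)).trans hy).isPeriod
        (Set.left_mem_Icc.2 zero_le_one) rfl rfl
    · exact hD.circles l hl

theorem addPrefix_singleton_mem (b : Bool) {t : ℝ} (ht : t ∈ Set.Icc (0 : ℝ) 1) :
    addPrefix [b] t ∈ Set.Icc (0 : ℝ) 1 := by
  obtain ⟨h0, h1⟩ := ht
  cases b <;> simp only [addPrefix] <;> constructor <;> norm_num <;> linarith

theorem Compatible.ruleI {D D' : Diagram} (hD : K.Compatible D) (h : RuleI D D') :
    K.Compatible D' := by
  obtain ⟨w, u, y, E, D₁, hE, h₁, h₂⟩ := h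
  have hy := hD.edges ⟨.mergeOut w, .splitIn u, y⟩ (by simp [hE])
  have hb : ∀ b, K.Transports (K.inChart (.mergeIn b w)) (K.height (InPort.mergeIn b w).vertex) y
      (K.outChart (.splitOut b u)) (K.height (OutPort.splitOut b u).vertex) := fun b =>
    ⟨fun t ht => hy.chart_eq _ (addPrefix_singleton_mem b ht), hy.height_lt⟩
  have h₀ : K.Compatible ⟨E, D.circles⟩ := ⟨fun e he => hD.edges e (by simp [hE, he]), hD.circles⟩
  exact (h₀.join h₁ (hb false)).join h₂ (hb true)

end Coordinates

/-! ### The places of a diagram -/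

namespace Diagram

/-- The places where the edges start. -/
def sources (D : Diagram) : Multiset OutPort := D.edges.map Edge.src

/-- The places where the edges end. -/
def targets (D : Diagram) : Multiset InPort := D.edges.map Edge.tgt

/-- For some collections of merges and splits, the edges start and end exactly at the places
belonging to them. -/
def IsBalanced (D : Diagram) : Prop :=
  ∃ W U : Multiset (List Bool),
    D.sources = W.map .mergeOut + (U.map (.splitOut false) + U.map (.splitOut true)) ∧
    D.targets = U.map .splitIn + (W.map (.mergeIn false) + W.map (.mergeIn true))

/-- There is at least one edge or circle. -/
def IsNonempty (D : Diagram) : Prop := D.edges ≠ 0 ∨ D.circles ≠ 0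

end Diagram

theorem Join.sources_eq {p : InPort} {q : OutPort} {y : Label} {D D' : Diagram}
    (h : Join p q y D D') : D.sources = q ::ₘ D'.sources := by
  cases h with
  | edge a b x z E C => simp [Diagram.sources, Multiset.cons_swap]
  | circle x E C => simp [Diagram.sources]

theorem Join.targets_eq {p : InPort} {q : OutPort} {y : Label} {D D' : Diagram}
    (h : Join p q y D D') : D.targets = p ::ₘ D'.targets := by
  cases h with
  | edge a b x z E C => simp [Diagram.targets]
  | circle x E C => simp [Diagram.targets]

theorem Join.isNonempty {p : InPort} {q : OutPort} {y : Label} {D D' : Diagram}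
    (h : Join p q y D D') : D'.IsNonempty := by
  cases h with
  | edge a b x z E C => exact .inl (Multiset.cons_ne_zero)
  | circle x E C => exact .inr (Multiset.cons_ne_zero)

theorem exists_join {p : InPort} {q : OutPort} (y : Label) {D : Diagram} (hp : p ∈ D.targets)
    (hq : q ∈ D.sources) : ∃ D', Join p q y D D' := by
  obtain ⟨E, C⟩ := D
  obtain ⟨⟨a, _, x⟩, he, rfl⟩ := Multiset.mem_map.1 hp
  obtain ⟨⟨_, b, z⟩, hf, rfl⟩ := Multiset.mem_map.1 hq
  obtain ⟨E, rfl⟩ := Multiset.exists_cons_of_mem he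
  rcases Multiset.mem_cons.1 hf with h | h
  · obtain ⟨rfl, rfl, rfl⟩ := Edge.mk.inj h
    exact ⟨_, .circle z E C⟩
  · obtain ⟨E, rfl⟩ := Multiset.exists_cons_of_mem h
    exact ⟨_, .edge a b x z E C⟩

theorem RuleI.isNonempty {D D' : Diagram} (h : RuleI D D') : D'.IsNonempty := by
  obtain ⟨_, _, _, _, _, _, _, h⟩ := h
  exact h.isNonempty

theorem RuleI.sources_eq_and_targets_eq {D D' : Diagram} (h : RuleI D D') :
    ∃ w u, D.sources = .mergeOut w ::ₘ .splitOut false u ::ₘ .splitOut true u ::ₘ D'.sources ∧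
      D.targets = .splitIn u ::ₘ .mergeIn false w ::ₘ .mergeIn true w ::ₘ D'.targets := by
  obtain ⟨w, u, y, E, D₁, hE, h₁, h₂⟩ := h
  refine ⟨w, u, ?_, ?_⟩
  · rw [← h₂.sources_eq, ← h₁.sources_eq]
    simp [Diagram.sources, hE]
  · rw [← h₂.targets_eq, ← h₁.targets_eq]
    simp [Diagram.targets, hE]

theorem RuleI.card_lt {D D' : Diagram} (h : RuleI D D') : D'.edges.card < D.edges.card := by
  obtain ⟨w, u, hs, -⟩ := h.sources_eq_and_targets_eq
  have := congrArg Multiset.card hs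
  simp only [Diagram.sources, Multiset.card_map, Multiset.card_cons] at this
  omega

theorem RuleI.isBalanced {D D' : Diagram} (h : RuleI D D') (hD : D.IsBalanced) :
    D'.IsBalanced := by
  obtain ⟨w, u, hs, ht⟩ := h.sources_eq_and_targets_eq
  obtain ⟨W, U, hW, hU⟩ := hD
  have hw : w ∈ W := by
    have : OutPort.mergeOut w ∈ D.sources := by simp [hs]
    simpa [hW] using this
  have hu : u ∈ U := by
    have : InPort.splitIn u ∈ D.targets := by simp [ht]
    simpa [hU] using this
  obtain ⟨W, rfl⟩ := Multiset.exists_cons_of_mem hw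
  obtain ⟨U, rfl⟩ := Multiset.exists_cons_of_mem hu
  refine ⟨W, U, ?_, ?_⟩
  · rw [← Multiset.cons_inj_right (.splitOut true u), ← Multiset.cons_inj_right (.splitOut false u),
      ← Multiset.cons_inj_right (.mergeOut w), ← hs, hW]
    simp only [← Multiset.singleton_add, Multiset.map_add, Multiset.map_singleton]
    abel
  · rw [← Multiset.cons_inj_right (.mergeIn true w), ← Multiset.cons_inj_right (.mergeIn false w),
      ← Multiset.cons_inj_right (.splitIn u), ← ht, hU]
    simp only [← Multiset.singleton_add, Multiset.map_add, Multiset.map_singleton]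
    abel

theorem Diagram.IsBalanced.exists_ruleI {D : Diagram} (hD : D.IsBalanced) (h : ¬ D.IsReduced) :
    ∃ D', RuleI D D' := by
  obtain ⟨w, u, y, he⟩ := not_not.1 h
  obtain ⟨W, U, hW, hU⟩ := hD
  obtain ⟨E, hE⟩ := Multiset.exists_cons_of_mem he
  have hw : w ∈ W := by
    have : OutPort.mergeOut w ∈ D.sources := by simp [Diagram.sources, hE]
    simpa [hW] using this
  have hu : u ∈ U := by
    have : InPort.splitIn u ∈ D.targets := by simp [Diagram.targets, hE]
    simpa [hU] using this
  have hs : ∀ b, OutPort.splitOut b u ∈ Multiset.map Edge.src E := fun b => by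
    have : OutPort.splitOut b u ∈ D.sources := by rw [hW]; cases b <;> simp [hu]
    simpa [Diagram.sources, hE] using this
  have ht : ∀ b, InPort.mergeIn b w ∈ Multiset.map Edge.tgt E := fun b => by
    have : InPort.mergeIn b w ∈ D.targets := by rw [hU]; cases b <;> simp [hw]
    simpa [Diagram.targets, hE] using this
  obtain ⟨D₁, h₁⟩ := exists_join y (D := ⟨E, D.circles⟩) (ht false) (hs false)
  have hs₁ : OutPort.splitOut true u ∈ D₁.sources := by
    have : OutPort.splitOut true u ∈ Diagram.sources ⟨E, D.circles⟩ := hs true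
    simpa [h₁.sources_eq] using this
  have ht₁ : InPort.mergeIn true w ∈ D₁.targets := by
    have : InPort.mergeIn true w ∈ Diagram.targets ⟨E, D.circles⟩ := ht true
    simpa [h₁.targets_eq] using this
  obtain ⟨D', h₂⟩ := exists_join y ht₁ hs₁
  exact ⟨D', w, u, y, E, D₁, hE, h₁, h₂⟩

/-- In a balanced diagram every edge is followed by an edge. -/
theorem Diagram.IsBalanced.exists_next {D : Diagram} (hD : D.IsBalanced) {e : Edge}
    (he : e ∈ D.edges) : ∃ f ∈ D.edges, e.tgt.vertex = f.src.vertex := by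
  obtain ⟨W, U, hW, hU⟩ := hD
  have ht : e.tgt ∈ D.targets := Multiset.mem_map_of_mem _ he
  have key : ∀ q : OutPort, q ∈ D.sources → e.tgt.vertex = q.vertex →
      ∃ f ∈ D.edges, e.tgt.vertex = f.src.vertex := by
    intro q hq h
    obtain ⟨f, hf, rfl⟩ := Multiset.mem_map.1 hq
    exact ⟨f, hf, h⟩
  rw [hU] at ht
  rcases h : e.tgt with u | ⟨b, w⟩
  · rw [← h]
    refine key (.splitOut false u) ?_ (by rw [h]; rfl)
    rw [h] at ht
    have : u ∈ U := by simpa using ht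
    simp [hW, this]
  · rw [← h]
    refine key (.mergeOut w) ?_ (by rw [h]; rfl)
    rw [h] at ht
    have : w ∈ W := by cases b <;> simpa using ht
    simp [hW, this]

/-- A finite set of edges each of which is followed by another one contains a cycle. -/
theorem Diagram.IsBalanced.exists_hasCycle {D : Diagram} (hD : D.IsBalanced)
    (hne : D.IsNonempty) : ∃ a b, D.HasCycle a b := by
  by_cases hC : D.circles = 0
  swap
  · obtain ⟨⟨b, a⟩, h⟩ := Multiset.exists_mem_of_ne_zero hC
    exact ⟨a, b, .inl h⟩
  obtain ⟨e₀, he₀⟩ := Multiset.exists_mem_of_ne_zero (hne.resolve_right (not_not.2 hC))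
  choose! next hnext hv using fun e (he : e ∈ D.edges) => hD.exists_next he
  have hmem : ∀ i, next^[i] e₀ ∈ D.edges := by
    intro i
    induction i with
    | zero => exact he₀
    | succ i ih => rw [Function.iterate_succ_apply']; exact hnext _ ih
  classical
  obtain ⟨i, -, j, -, hij, h⟩ := Set.infinite_univ.exists_lt_map_eq_of_mapsTo
    (f := fun i => next^[i] e₀) (t := {e | e ∈ D.edges}) (fun i _ => hmem i)
    (by simp [← Multiset.mem_toFinset])
  obtain ⟨m, rfl⟩ := Nat.exists_eq_add_of_lt hij
  refine ⟨_, _, .inr ⟨(List.range (m + 1)).map fun k => next^[i + k] e₀, by simp, ?_, ?_, rfl, rfl⟩⟩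
  · intro e he
    obtain ⟨k, -, rfl⟩ := List.mem_map.1 he
    exact hmem _
  · rw [← Cycle.map_coe, Cycle.chain_map, Cycle.chain_range_succ]
    refine ⟨?_, fun k _ => ?_⟩
    · have h' := hv _ (hmem (i + m))
      rw [← Function.iterate_succ_apply' next] at h'
      rw [h', add_zero]
      exact congrArg (fun e : Edge => e.src.vertex) h.symm
    · have h' := hv _ (hmem (i + k))
      rwa [← Function.iterate_succ_apply' next] at h'

/-! ### Cycles in reduced diagrams -/

namespace Coordinates

variable {K : Coordinates}

theorem Transports.comp {φ ψ : ℝ → ℝ} {h k : ℤ} {l : Label} (H : K.Transports φ h l ψ k)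
    {s : ℝ → ℝ} (hs : Set.MapsTo s (Set.Icc 0 1) (Set.Icc 0 1)) :
    K.Transports (φ ∘ s) h l (ψ ∘ s) k :=
  ⟨fun t ht => H.chart_eq (s t) (hs ht), H.height_lt⟩

theorem mapsTo_addPrefix_singleton (b : Bool) :
    Set.MapsTo (addPrefix [b]) (Set.Icc 0 1) (Set.Icc 0 1) :=
  fun _ => addPrefix_singleton_mem b

theorem Compatible.merge_step {D : Diagram} (hD : K.Compatible D) (hr : D.IsReduced) {e : Edge}
    (he : e ∈ D.edges) (hm : ∃ w, e.src.vertex = .merge w) :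
    (∃ w, e.tgt.vertex = .merge w) ∧
      ∃ s : ℝ → ℝ, Continuous s ∧ Set.MapsTo s (Set.Icc 0 1) (Set.Icc 0 1) ∧
        K.Transports (K.chart e.src.vertex) (K.height e.src.vertex) e.label
          (K.chart e.tgt.vertex ∘ s) (K.height e.tgt.vertex) := by
  have H := hD.edges e he
  obtain ⟨_ | w, u | ⟨b, w'⟩, y⟩ := e
  · obtain ⟨w, hw⟩ := hm
    exact absurd hw Vertex.noConfusion
  · obtain ⟨w, hw⟩ := hm
    exact absurd hw Vertex.noConfusion
  · exact absurd ⟨w, u, y, he⟩ hr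
  · exact ⟨⟨w', rfl⟩, addPrefix [b], continuous_addPrefix _, mapsTo_addPrefix_singleton b, H⟩

theorem Compatible.split_step {D : Diagram} (hD : K.Compatible D) (hr : D.IsReduced) {e : Edge}
    (he : e ∈ D.edges) (hm : ∃ u, e.tgt.vertex = .split u) :
    (∃ u, e.src.vertex = .split u) ∧
      ∃ s : ℝ → ℝ, Continuous s ∧ Set.MapsTo s (Set.Icc 0 1) (Set.Icc 0 1) ∧
        K.Transports (K.chart e.src.vertex ∘ s) (K.height e.src.vertex) e.label
          (K.chart e.tgt.vertex) (K.height e.tgt.vertex) := by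
  have H := hD.edges e he
  obtain ⟨⟨b, u'⟩ | w, u | _, y⟩ := e
  · exact ⟨⟨u', rfl⟩, addPrefix [b], continuous_addPrefix _, mapsTo_addPrefix_singleton b, H⟩
  · obtain ⟨w, hw⟩ := hm
    exact absurd hw Vertex.noConfusion
  · exact absurd ⟨w, u, y, he⟩ hr
  · obtain ⟨w, hw⟩ := hm
    exact absurd hw Vertex.noConfusion

theorem Compatible.merge_path {D : Diagram} (hD : K.Compatible D) (hr : D.IsReduced) {e f : Edge}
    {l : List Edge} (hl : ∀ x ∈ e :: l, x ∈ D.edges)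
    (hc : List.IsChain (fun e f : Edge => e.tgt.vertex = f.src.vertex) (e :: (l ++ [f])))
    (hm : ∃ w, e.src.vertex = .merge w) :
    ∃ s : ℝ → ℝ, Continuous s ∧ Set.MapsTo s (Set.Icc 0 1) (Set.Icc 0 1) ∧
      K.Transports (K.chart e.src.vertex) (K.height e.src.vertex)
        ((e :: l).map Edge.label).sum (K.chart f.src.vertex ∘ s) (K.height f.src.vertex) := by
  induction l generalizing e with
  | nil =>
    obtain ⟨-, s, hs, hs', H⟩ := hD.merge_step hr (hl e (by simp)) hm
    have h : e.tgt.vertex = f.src.vertex := by simpa using hc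
    rw [h] at H
    exact ⟨s, hs, hs', by simpa using H⟩
  | cons e' l ih =>
    obtain ⟨hm', s, hs, hs', H⟩ := hD.merge_step hr (hl e (by simp)) hm
    rw [List.cons_append, List.isChain_cons_cons] at hc
    rw [hc.1] at H hm'
    obtain ⟨s', hc', hm'', H'⟩ := ih (fun x hx => hl x (List.mem_cons_of_mem _ hx)) hc.2 hm'
    exact ⟨s' ∘ s, hc'.comp hs, hm''.comp hs', H.trans (H'.comp hs')⟩

theorem Compatible.split_path {D : Diagram} (hD : K.Compatible D) (hr : D.IsReduced) {e f : Edge}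
    {l : List Edge} (hl : ∀ x ∈ e :: l, x ∈ D.edges)
    (hc : List.IsChain (fun e f : Edge => e.tgt.vertex = f.src.vertex) (e :: (l ++ [f])))
    (hm : ∃ u, f.src.vertex = .split u) :
    (∃ u, e.src.vertex = .split u) ∧
    ∃ s : ℝ → ℝ, Continuous s ∧ Set.MapsTo s (Set.Icc 0 1) (Set.Icc 0 1) ∧
      K.Transports (K.chart e.src.vertex ∘ s) (K.height e.src.vertex)
        ((e :: l).map Edge.label).sum (K.chart f.src.vertex) (K.height f.src.vertex) := by
  induction l generalizing e with
  | nil =>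
    have h : e.tgt.vertex = f.src.vertex := by simpa using hc
    obtain ⟨hm', s, hs, hs', H⟩ := hD.split_step hr (hl e (by simp)) (h ▸ hm)
    rw [h] at H
    exact ⟨hm', s, hs, hs', by simpa using H⟩
  | cons e' l ih =>
    rw [List.cons_append, List.isChain_cons_cons] at hc
    obtain ⟨hm', s', hc', hm'', H'⟩ := ih (fun x hx => hl x (List.mem_cons_of_mem _ hx)) hc.2
    obtain ⟨hm₁, s, hs, hs', H⟩ := hD.split_step hr (hl e (by simp)) (hc.1 ▸ hm')
    rw [hc.1] at H
    exact ⟨hm₁, s ∘ s', hs.comp hc', hs'.comp hm'', (H.comp hm'').trans H'⟩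

theorem sum_map_label (l : List Edge) :
    (l.map Edge.label).sum =
      ((l.map fun e => e.label.1).sum, (l.map fun e => e.label.2).sum) := by
  induction l with
  | nil => rfl
  | cons e l ih => simp [ih, Prod.ext_iff]

/-- The labels along any cycle of a reduced diagram are those of a periodic point. -/
theorem Compatible.isPeriod {D : Diagram} (hD : K.Compatible D) (hr : D.IsReduced) {a b : ℕ}
    (h : D.HasCycle a b) : K.IsPeriod (b, a) := by
  rcases h with h | ⟨_ | ⟨e, l⟩, hne, hl, hc, rfl, rfl⟩
  · exact hD.circles _ h
  · exact absurd rfl hne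
  rw [Cycle.chain_coe_cons] at hc
  rw [← sum_map_label]
  rcases hv : e.src.vertex with u | w
  · obtain ⟨-, s, hs, hm, H⟩ := hD.split_path hr hl hc ⟨u, hv⟩
    obtain ⟨t, ht, hfix⟩ := exists_mem_Icc_isFixedPt_of_mapsTo hs.continuousOn zero_le_one hm
    exact H.isPeriod ht (congrArg (K.chart _) hfix) rfl
  · obtain ⟨s, hs, hm, H⟩ := hD.merge_path hr hl hc ⟨w, hv⟩
    obtain ⟨t, ht, hfix⟩ := exists_mem_Icc_isFixedPt_of_mapsTo hs.continuousOn zero_le_one hm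
    exact H.isPeriod ht rfl (congrArg (K.chart _) hfix)

end Coordinates

/-! ### The diagram of a pair of trees -/

theorem above_append (u : List Bool) (b : Bool) : above (u ++ [b]) = .splitOut b u := by
  simp [above]

theorem below_append (w : List Bool) (b : Bool) : below (w ++ [b]) = .mergeIn b w := by
  simp [below]

theorem addPrefix_append (u v : List Bool) (t : ℝ) :
    addPrefix (u ++ v) t = addPrefix u (addPrefix v t) := by
  induction u with
  | nil => rfl
  | cons b u ih => simp [addPrefix, ih]

theorem eq_nil_of_nil_mem_leaves {A : BinaryTree Unit} (h : [] ∈ leaves A) : A = .nil := by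
  cases A with
  | nil => rfl
  | node _ l r => simp [leaves] at h

theorem length_lt_of_mem_leaves {A : BinaryTree Unit} {u : List Bool} (h : u ∈ leaves A) :
    u.length < A.numLeaves := by
  induction A generalizing u with
  | nil => simp_all [leaves, BinaryTree.numLeaves]
  | node _ l r hl hr =>
    have := l.numLeaves_pos
    have := r.numLeaves_pos
    simp only [leaves, List.mem_append, List.mem_map] at h
    rw [BinaryTree.numLeaves]
    rcases h with ⟨v, hv, rfl⟩ | ⟨v, hv, rfl⟩
    · have := hl hv
      simp only [List.length_cons]
      omega
    · have := hr hv
      simp only [List.length_cons]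
      omega

theorem eq_nil_of_numLeaves_eq_one {A : BinaryTree Unit} (h : A.numLeaves = 1) : A = .nil := by
  cases A with
  | nil => rfl
  | node _ l r =>
    have := l.numLeaves_pos
    have := r.numLeaves_pos
    rw [BinaryTree.numLeaves] at h
    omega

/-- The vertices of a tree are the root and the children of the carets. -/
theorem carets_add_leaves (A : BinaryTree Unit) :
    (carets A : Multiset (List Bool)) + (leaves A : Multiset (List Bool)) =
      [] ::ₘ ((carets A : Multiset (List Bool)).map (· ++ [false]) +
        (carets A : Multiset (List Bool)).map (· ++ [true])) := by
  induction A with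
  | nil => simp [carets, leaves]
  | node _ l r hl hr =>
    have hl' := congrArg (Multiset.map (List.cons false)) hl
    have hr' := congrArg (Multiset.map (List.cons true)) hr
    simp only [Multiset.map_add, Multiset.map_cons, Multiset.map_map, Function.comp_def] at hl' hr'
    simp only [carets, leaves, ← Multiset.cons_coe, ← Multiset.coe_add, ← Multiset.map_coe,
      Multiset.cons_add, Multiset.map_add, Multiset.map_cons, Multiset.map_map, Function.comp_def,
      List.nil_append, List.cons_append]
    rw [add_add_add_comm, hl', hr']
    simp only [← Multiset.singleton_add]
    abel

namespace TreePair

theorem domLeaf_mem (P : TreePair) {i : ℕ} (hi : i < P.n) : P.domLeaf i ∈ leaves P.dom := by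
  have h : i < (leaves P.dom).length := by rwa [length_leaves]
  rw [domLeaf, List.getD_eq_getElem _ _ h]
  exact List.getElem_mem h

theorem ranLeaf_mem (P : TreePair) {i : ℕ} (hi : i < P.n) : P.ranLeaf i ∈ leaves P.ran := by
  have h : (i + P.shift) % P.n < (leaves P.ran).length := by
    rw [length_leaves, ← P.numLeaves_eq]
    exact Nat.mod_lt _ (by omega)
  rw [ranLeaf, List.getD_eq_getElem _ _ h]
  exact List.getElem_mem h

theorem map_domLeaf (P : TreePair) : (List.range P.n).map P.domLeaf = leaves P.dom := by
  apply List.ext_getElem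
  · simp [length_leaves, n]
  · intro i _ hi
    simp only [List.getElem_map, List.getElem_range, domLeaf]
    rw [List.getD_eq_getElem _ _ hi]

theorem map_ranLeaf (P : TreePair) :
    (((List.range P.n).map P.ranLeaf : List (List Bool)) : Multiset (List Bool)) =
      leaves P.ran := by
  have h : (List.range P.n).map P.ranLeaf = (leaves P.ran).rotate P.shift := by
    apply List.ext_getElem
    · simp [length_leaves, n, P.numLeaves_eq]
    · intro i _ hi
      have hi' : i < P.n := by simpa [length_leaves, n, P.numLeaves_eq] using hi
      have hn : (leaves P.ran).length = P.n := by rw [length_leaves, ← P.numLeaves_eq, n]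
      have h : (i + P.shift) % P.n < (leaves P.ran).length := by
        rw [hn]
        exact Nat.mod_lt _ (by omega)
      simp only [List.getElem_map, List.getElem_range, ranLeaf]
      rw [List.getD_eq_getElem _ _ h, List.getElem_rotate]
      simp only [hn]
  rw [h, Multiset.coe_eq_coe]
  exact List.rotate_perm _ _

theorem isNonempty_torusDiagram (P : TreePair) : P.torusDiagram.IsNonempty := by
  rw [torusDiagram]
  split_ifs with h
  · exact .inr (by simp)
  · refine .inl ?_
    have : P.n ≠ 0 := fun h0 => absurd P.shift_lt (by rw [← n]; omega)
    simp [this]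

theorem carets_eq_cons (A : BinaryTree Unit) (h : A.numLeaves ≠ 1) :
    (carets A : Multiset (List Bool)) =
      [] ::ₘ (((carets A).filter (fun w => w ≠ []) : List _) : Multiset (List Bool)) := by
  cases A with
  | nil => exact absurd rfl h
  | node _ l r => simp [carets, List.filter_eq_self.2]

theorem isBalanced_torusDiagram (P : TreePair) : P.torusDiagram.IsBalanced := by
  by_cases h : P.n = 1
  · refine ⟨0, 0, ?_, ?_⟩ <;> simp [torusDiagram, h, Diagram.sources, Diagram.targets]
  have hW := carets_eq_cons P.ran (by rwa [← P.numLeaves_eq])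
  refine ⟨carets P.ran, carets P.dom, ?_, ?_⟩
  · have h₁ := congrArg (Multiset.map above) (carets_add_leaves P.dom)
    rw [← P.map_domLeaf] at h₁
    have h₂ := congrArg (Multiset.map OutPort.mergeOut) hW
    simp only [Multiset.map_add, Multiset.map_singleton, Multiset.map_map, Function.comp_def,
      above_append, ← Multiset.map_coe, ← Multiset.singleton_add] at h₁ h₂ ⊢
    simp only [torusDiagram, if_neg h, Diagram.sources, ← Multiset.coe_add, ← Multiset.map_coe,
      Multiset.map_add, Multiset.map_map, Function.comp_def]
    rw [h₂, add_right_comm, h₁]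
    rw [show above [] = .mergeOut [] from rfl]
    abel
  · have h₁ := carets_add_leaves P.ran
    rw [hW, Multiset.cons_add, Multiset.cons_inj_right, ← hW, ← P.map_ranLeaf] at h₁
    replace h₁ := congrArg (Multiset.map below) h₁
    simp only [Multiset.map_add, Multiset.map_map, Function.comp_def, below_append,
      ← Multiset.map_coe] at h₁ ⊢
    simp only [torusDiagram, if_neg h, Diagram.targets, ← Multiset.coe_add, ← Multiset.map_coe,
      Multiset.map_add, Multiset.map_map, Function.comp_def]
    rw [add_assoc, h₁]

theorem compatible_torusDiagram (P : TreePair) {F : ℝ ≃o ℝ} {f : CircleDeg1Lift} (hf : ⇑f = F)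
    (hF : ∀ i < P.n, ∀ t ∈ Set.Icc (0 : ℝ) 1, F (addPrefix (P.domLeaf i) t) =
      addPrefix (P.ranLeaf i) t + if P.n ≤ i + P.shift then 1 else 0) :
    ∃ K : Coordinates, K.lift = f ∧ K.Compatible P.torusDiagram := by
  refine ⟨⟨f, 2 * P.n + 1,
    fun v => Vertex.rec (fun u => addPrefix u) (fun w t => F.symm (addPrefix w t)) v,
    fun v => Vertex.rec (fun u => (u.length : ℤ)) (fun w => 2 * P.n - (w.length : ℤ)) v⟩, rfl, ?_⟩
  rw [torusDiagram]
  split_ifs with h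
  · refine ⟨by simp, fun l hl => ?_⟩
    obtain rfl : l = (1, 0) := by simpa using hl
    have hd : P.dom = .nil := eq_nil_of_numLeaves_eq_one h
    have hr : P.ran = .nil := eq_nil_of_numLeaves_eq_one (P.numLeaves_eq ▸ h)
    have hs : P.shift = 0 := by have := P.shift_lt; rw [← n] at this; omega
    have := hF 0 (by omega) 0 (by simp)
    exact ⟨one_pos, 0, by simpa [hf, domLeaf, ranLeaf, hd, hr, hs, h, leaves, addPrefix] using this⟩
  refine ⟨fun e he => ?_, by simp⟩
  simp only [Multiset.mem_coe, List.mem_append, List.mem_map, List.mem_filter, List.mem_range] at he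
  rcases he with (⟨u, hu, rfl⟩ | ⟨w, ⟨hw, hw0⟩, rfl⟩) | ⟨i, hi, rfl⟩
  · rcases List.eq_nil_or_concat' u with rfl | ⟨v, b, rfl⟩
    · constructor
      · intro t _
        simp [above, Coordinates.outChart, Coordinates.inChart, hf, addPrefix]
      · simp [above, OutPort.vertex, InPort.vertex]
    · simp only [above_append]
      constructor
      · intro t _
        simp [Coordinates.outChart, Coordinates.inChart, addPrefix_append]
      · simp [OutPort.vertex, InPort.vertex]
  · rcases List.eq_nil_or_concat' w with rfl | ⟨v, b, rfl⟩
    · simp at hw0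
    · simp only [below_append]
      constructor
      · intro t _
        simp [Coordinates.outChart, Coordinates.inChart, addPrefix_append]
      · simp [OutPort.vertex, InPort.vertex]
  · have hu := P.domLeaf_mem hi
    have hw := P.ranLeaf_mem hi
    have hd := length_lt_of_mem_leaves hu
    have hr := length_lt_of_mem_leaves hw
    have hi' := hF i hi
    have hn := P.numLeaves_eq
    have hn' : P.n = P.dom.numLeaves := rfl
    rcases List.eq_nil_or_concat' (P.domLeaf i) with h0 | ⟨u, b, hub⟩
    · rw [h0] at hu
      rw [n, eq_nil_of_nil_mem_leaves hu] at h
      exact absurd rfl h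
    rcases List.eq_nil_or_concat' (P.ranLeaf i) with h0 | ⟨w, c, hwc⟩
    · rw [h0] at hw
      rw [n, P.numLeaves_eq, eq_nil_of_nil_mem_leaves hw] at h
      exact absurd rfl h
    rw [hub] at hd hi'
    rw [hwc] at hr hi'
    simp only [hub, hwc, above_append, below_append]
    simp only [List.length_append, List.length_singleton] at hd hr
    constructor
    · intro t ht
      have := hi' t ht
      rw [addPrefix_append, addPrefix_append] at this
      simp only [Coordinates.outChart, Coordinates.inChart]
      split_ifs with hk
      · rw [if_pos hk] at this
        simp only [pow_zero, CircleDeg1Lift.coe_one, id, Nat.cast_one]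
        apply F.injective
        rw [this, ← hf, f.map_add_one, hf, F.apply_symm_apply]
      · rw [if_neg hk, add_zero] at this
        simp only [pow_zero, CircleDeg1Lift.coe_one, id, Nat.cast_zero, add_zero]
        rw [← this, F.symm_apply_apply]
    · split_ifs <;> simp only [OutPort.vertex, InPort.vertex] <;> push_cast <;> omega

end TreePair

end RotT

theorem mainTheorem2 (g : UnitAddCircle ≃ₜ UnitAddCircle) (hg : g ∈ RotT.thompsonT) :
    -- step (1) of the algorithm is possible, and whichever pair of trees is used:
    (∃ P : RotT.TreePair, P.Represents g) ∧
    ∀ P : RotT.TreePair, P.Represents g →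
      -- step (2) terminates,
      (¬ ∃ D : ℕ → RotT.Diagram, D 0 = P.torusDiagram ∧ ∀ i, RotT.RuleI (D i) (D (i + 1))) ∧
      ∀ D : RotT.Diagram, Relation.ReflTransGen RotT.RuleI P.torusDiagram D →
        -- it can be continued as long as there are merge-split pairs,
        (¬ D.IsReduced → ∃ D' : RotT.Diagram, RotT.RuleI D D') ∧
        -- and when there are none left, any oriented cycle gives the rotation number.
        (D.IsReduced →
          (∃ a b : ℕ, D.HasCycle a b) ∧
          ∀ a b : ℕ, D.HasCycle a b →
            0 < b ∧ RotT.HasRotationNumber g (((a : ℝ) / (b : ℝ) : ℝ) : UnitAddCircle)) := by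
  refine ⟨hg, fun P hP => ⟨?_, fun D hD => ?_⟩⟩
  · rintro ⟨D, -, hD⟩
    exact not_strictAnti_of_wellFoundedLT (fun i => (D i).edges.card)
      (strictAnti_nat_of_succ_lt fun i => (hD i).card_lt)
  obtain ⟨F, hF, hF1, hleaf⟩ := hP.exists_isLift
  let f : CircleDeg1Lift := ⟨⟨F, F.monotone⟩, hF1⟩
  have hf : ⇑f = F := rfl
  obtain ⟨K, hK, hcomp⟩ := P.compatible_torusDiagram hf hleaf
  have hinv : D.IsBalanced ∧ D.IsNonempty ∧ K.Compatible D := by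
    induction hD with
    | refl => exact ⟨P.isBalanced_torusDiagram, P.isNonempty_torusDiagram, hcomp⟩
    | tail _ h ih => exact ⟨h.isBalanced ih.1, h.isNonempty, ih.2.2.ruleI h⟩
  obtain ⟨hbal, hne, hcomp⟩ := hinv
  refine ⟨hbal.exists_ruleI, fun hr => ⟨hbal.exists_hasCycle hne, fun a b hab => ?_⟩⟩
  obtain ⟨hb, x, hx⟩ := hcomp.isPeriod hr hab
  rw [hK] at hx
  exact ⟨hb, RotT.hasRotationNumber_of_pow_eq hF hf hb hx⟩
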